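/- For $n\ge 1$, a real net $\{c_\alpha\}_{\alpha\in\mathbb Z_+^n}$ (with $\mathbb Z_+=\{0,1,2,\dots\}$) is called joint completely monotone if $(-1)^{|\beta|}\triangle^\beta c_\alpha\ge 0$ for all $\alpha,\beta\in\mathbb Z_+^n$, where $\triangle^\beta=\triangle_1^{\beta_1}\cdots\triangle_n^{\beta_n}$, $\triangle_j c_\alpha=c_{\alpha+\varepsilon_j}-c_\alpha$, $\varepsilon_j$ is the $j$-th standard basis vector, and $|\beta|=\beta_1+\dots+\beta_n$; for $n=1$ one speaks of a completely monotone sequence. A joint completely monotone net is minimal if for every $j=1,\dots,n$ and every $\epsilon>0$ the sequence $\{c_{k\varepsilon_j}-\epsilon\,\mathbf 1_{\{0\}}(k)\}_{k\in\mathbb Z_+}$ is not completely monotone. **Theorem.** Let $a_0,a_1,a_2,b_0,b_1,b_2\in(0,\infty)$ with $a_1\le a_2$ and $b_1\le b_2$, and let $a(x)=a_0(x+a_1)(x+a_2)$ and $b(x)=b_0(x+b_1)(x+b_2)$. Then: (i) if ($b_1\le a_1\le b_2$ or $b_1\le a_2\le b_2$) and $b_1+b_2\le a_1+a_2$, then $\left\{\frac{1}{b(m)+a(m)n}\right\}_{m,n\in\mathbb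 Z_+}$ is a minimal joint completely monotone net; (ii) if $\left\{\frac{1}{b(m)+a(m)n}\right\}_{m,n\in\mathbb Z_+}$ is joint completely monotone, then $\frac1{a_1}+\frac1{a_2}\le\frac1{b_1}+\frac1{b_2}$ and $b_1+b_2\le a_1+a_2$. -/

import Mathlib

/-- The difference operator `Δ^β = Δ₁^{β₁} ⋯ Δₙ^{βₙ}` on real nets indexed by `ℤ₊ⁿ`, where
`(Δⱼ a) α = a (α + εⱼ) - a α` and `εⱼ` is the `j`-th standard basis vector. The `Δⱼ` commute, so
the order of composition is immaterial. -/
def netDiff {n : ℕ} (β : Fin n → ℕ) (a : (Fin n → ℕ) → ℝ) : (Fin n → ℕ) → ℝ :=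
  (List.finRange n).foldr (fun j f => (fwdDiff (Pi.single j 1))^[β j] f) a

/-- Joint completely monotone nets: `(-1)^{|β|} Δ^β a_α ≥ 0` for all `α, β ∈ ℤ₊ⁿ`. -/
def JointCompletelyMonotone {n : ℕ} (a : (Fin n → ℕ) → ℝ) : Prop :=
  ∀ β α : Fin n → ℕ, 0 ≤ (-1 : ℝ) ^ (∑ j, β j) * netDiff β a α

/-- Completely monotone sequences (the one-variable case). -/
def CompletelyMonotoneSeq (a : ℕ → ℝ) : Prop :=
  ∀ k m : ℕ, 0 ≤ (-1 : ℝ) ^ k * (fwdDiff 1)^[k] a m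

/-- A joint completely monotone net is minimal if, for every coordinate `j` and every `ε > 0`,
subtracting `ε` from the zeroth term of the sequence `k ↦ a (k εⱼ)` gives a sequence which is not
completely monotone. -/
def MinimalJointCompletelyMonotone {n : ℕ} (a : (Fin n → ℕ) → ℝ) : Prop :=
  JointCompletelyMonotone a ∧
    ∀ (j : Fin n) (ε : ℝ), 0 < ε →
      ¬ CompletelyMonotoneSeq (fun k => a (Pi.single j k) - if k = 0 then ε else 0)

open Filter Topology

/-! ### Complete monotonicity up to a finite order -/

/-! Put `h = b / a`. For fixed `m`, the signed `k`-th difference in `n` of `1 / (b + a n)` is `k! /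
(a ∏_{i ≤ k} (h + n + i))` (`fwdDiff_iter_one_div_linear`), so joint complete monotonicity says that
these expressions are completely monotone in `m`.

Sufficiency: under interlacing, `h` is a constant minus a completely monotone sequence, so its
increments are completely monotone. Hence so are the factors `1 / (h + n + i)` (`CMUpTo.one_div`)
and their products.

Necessity: as `k` grows the products decay like `k ^ (-h)`, so an inequality between two of them for
all `k` orders the values of `h` (`le_of_forall_prod_le`). Monotonicity in `m` gives `h m ≤ h (m +
1)`, whose limit `m → ∞` is the condition on sums. The condition on reciprocals is `h'(0) ≥ 0` and
needs non-integer points: Newton series recover the rational functions on `[0, 1]` from their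
differences at `0`, and the signs of the binomial coefficients give `f x ≤ f 0`. So `h 0 ≤ h x`, and
`x → 0⁺`.

Minimality: an atom at `0` would keep the signed differences at `0` above some `ε > 0`, but they
tend to zero. -/

/-- Complete monotonicity up to order `N`: the first `N` backward differences are nonnegative. -/
def CMUpTo : ℕ → (ℕ → ℝ) → Prop
  | 0, u => ∀ m, 0 ≤ u m
  | N + 1, u => (∀ m, 0 ≤ u m) ∧ CMUpTo N (fun m => u m - u (m + 1))

theorem CMUpTo.of_succ {N : ℕ} {u : ℕ → ℝ} (h : CMUpTo (N + 1) u) : CMUpTo N u := by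
  induction N generalizing u with
  | zero => exact h.1
  | succ N ih => exact ⟨h.1, ih h.2⟩

theorem CMUpTo.shift {N : ℕ} {u : ℕ → ℝ} (h : CMUpTo N u) : CMUpTo N (fun m => u (m + 1)) := by
  induction N generalizing u with
  | zero => exact fun m => h (m + 1)
  | succ N ih => exact ⟨fun m => h.1 (m + 1), ih h.2⟩

theorem CMUpTo.add {N : ℕ} {u v : ℕ → ℝ} (hu : CMUpTo N u) (hv : CMUpTo N v) :
    CMUpTo N (fun m => u m + v m) := by
  induction N generalizing u v with
  | zero => exact fun m => add_nonneg (hu m) (hv m)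
  | succ N ih =>
    refine ⟨fun m => add_nonneg (hu.1 m) (hv.1 m), ?_⟩
    convert ih hu.2 hv.2 using 2
    ring

theorem CMUpTo.mul {N : ℕ} {u v : ℕ → ℝ} (hu : CMUpTo N u) (hv : CMUpTo N v) :
    CMUpTo N (fun m => u m * v m) := by
  induction N generalizing u v with
  | zero => exact fun m => mul_nonneg (hu m) (hv m)
  | succ N ih =>
    refine ⟨fun m => mul_nonneg (hu.1 m) (hv.1 m), ?_⟩
    -- Discrete Leibniz rule: `u v - u' v' = u (v - v') + (u - u') v'`, primes denoting the shift.
    convert (ih hu.of_succ hv.2).add (ih hu.2 hv.of_succ.shift) using 2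
    ring

theorem CMUpTo.const {c : ℝ} (hc : 0 ≤ c) (N : ℕ) : CMUpTo N (fun _ => c) := by
  induction N generalizing c with
  | zero => exact fun _ => hc
  | succ N ih =>
    refine ⟨fun _ => hc, ?_⟩
    convert ih le_rfl using 2
    ring

/-- The reciprocal of a positive sequence with completely monotone increments is completely
monotone. -/
theorem CMUpTo.one_div {w : ℕ → ℝ} (hw : ∀ m, 0 < w m)
    (h : ∀ N, CMUpTo N (fun m => w (m + 1) - w m)) (N : ℕ) : CMUpTo N (fun m => 1 / w m) := by
  induction N with
  | zero => exact fun m => (one_div_pos.2 (hw m)).le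
  | succ N ih =>
    refine ⟨fun m => (one_div_pos.2 (hw m)).le, ?_⟩
    -- `1 / w - 1 / w' = (w' - w) (1 / w) (1 / w')`, which needs the reciprocal only to order `N`.
    convert ((h N).mul ih).mul ih.shift using 2 with m
    have h₁ := (hw m).ne'
    have h₂ := (hw (m + 1)).ne'
    field_simp

theorem CMUpTo.one_div_add {c : ℝ} (hc : 0 < c) (N : ℕ) :
    CMUpTo N (fun m : ℕ => 1 / ((m : ℝ) + c)) := by
  refine CMUpTo.one_div (fun m => by positivity) (fun N => ?_) N
  convert CMUpTo.const zero_le_one N using 2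
  push_cast
  ring

theorem CMUpTo.prod {ι : Type*} {s : Finset ι} {u : ι → ℕ → ℝ} {N : ℕ}
    (h : ∀ i ∈ s, CMUpTo N (u i)) : CMUpTo N (fun m => ∏ i ∈ s, u i m) := by
  classical
  induction s using Finset.induction_on with
  | empty => simpa using CMUpTo.const zero_le_one N
  | insert i s hi ih =>
    simp only [Finset.prod_insert hi]
    exact (h i (Finset.mem_insert_self _ _)).mul
      (ih fun j hj => h j (Finset.mem_insert_of_mem hj))

theorem CMUpTo.fwdDiff_iter_nonneg {N : ℕ} {u : ℕ → ℝ} (h : CMUpTo N u) (m : ℕ) :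
    0 ≤ (-1 : ℝ) ^ N * (fwdDiff 1)^[N] u m := by
  induction N generalizing u with
  | zero => simpa using h m
  | succ N ih =>
    have := ih h.2
    have e : (fun m => u m - u (m + 1)) = (-1 : ℝ) • fwdDiff 1 u := by
      ext m
      simp [fwdDiff]
    rw [e, fwdDiff_iter_const_smul] at this
    rw [Function.iterate_succ_apply, pow_succ]
    simpa [mul_assoc] using this

theorem completelyMonotoneSeq_of_cmUpTo {u : ℕ → ℝ} (h : ∀ N, CMUpTo N u) :
    CompletelyMonotoneSeq u :=
  fun k m => (h k).fwdDiff_iter_nonneg m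

/-! ### Differences of the net -/

theorem fwdDiff_iter_single_zero (g : ℕ → ℕ → ℝ) (k : ℕ) :
    (fwdDiff (Pi.single (0 : Fin 2) 1))^[k] (fun α : Fin 2 → ℕ => g (α 0) (α 1)) =
      fun α => (fwdDiff 1)^[k] (fun m => g m (α 1)) (α 0) := by
  induction k with
  | zero => rfl
  | succ k ih =>
    rw [Function.iterate_succ_apply', ih]
    ext α
    rw [Function.iterate_succ_apply']
    simp [fwdDiff]

theorem fwdDiff_iter_single_one (g : ℕ → ℕ → ℝ) (k : ℕ) :
    (fwdDiff (Pi.single (1 : Fin 2) 1))^[k] (fun α : Fin 2 → ℕ => g (α 0) (α 1)) =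
      fun α => (fwdDiff 1)^[k] (g (α 0)) (α 1) := by
  induction k with
  | zero => rfl
  | succ k ih =>
    rw [Function.iterate_succ_apply', ih]
    ext α
    rw [Function.iterate_succ_apply']
    simp [fwdDiff]

theorem netDiff_two (g : ℕ → ℕ → ℝ) (β α : Fin 2 → ℕ) :
    netDiff β (fun α => g (α 0) (α 1)) α =
      (fwdDiff 1)^[β 0] (fun m => (fwdDiff 1)^[β 1] (g m) (α 1)) (α 0) := by
  have : List.finRange 2 = [0, 1] := by decide
  rw [netDiff, this]
  simp only [List.foldr_cons, List.foldr_nil]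
  rw [fwdDiff_iter_single_one, fwdDiff_iter_single_zero
    (fun m n => (fwdDiff 1)^[β 1] (g m) n)]

theorem jointCompletelyMonotone_two_iff (g : ℕ → ℕ → ℝ) :
    JointCompletelyMonotone (fun α : Fin 2 → ℕ => g (α 0) (α 1)) ↔
      ∀ k n, CompletelyMonotoneSeq (fun m => (-1) ^ k * (fwdDiff 1)^[k] (g m) n) := by
  have key : ∀ k n j m : ℕ,
      (fwdDiff 1)^[j] (fun m => (-1) ^ k * (fwdDiff 1)^[k] (g m) n) m =
        (-1) ^ k * (fwdDiff 1)^[j] (fun m => (fwdDiff 1)^[k] (g m) n) m := by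
    intro k n j m
    have := fwdDiff_iter_const_smul (1 : ℕ) ((-1 : ℝ) ^ k)
      (fun m => (fwdDiff 1)^[k] (g m) n) j
    exact congrFun this m
  constructor
  · intro h k n j m
    have := h ![j, k] ![m, n]
    rw [netDiff_two] at this
    simp only [Fin.sum_univ_two, Matrix.cons_val_zero, Matrix.cons_val_one] at this
    rw [key, ← mul_assoc, ← pow_add]
    exact this
  · intro h β α
    have := h (β 1) (α 1) (β 0) (α 0)
    rw [key, ← mul_assoc, ← pow_add] at this
    rw [netDiff_two, Fin.sum_univ_two]
    exact this

theorem fwdDiff_iter_one_div_linear {A h : ℝ} (hA : 0 < A) (hh : 0 < h) (k n : ℕ) :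
    (-1 : ℝ) ^ k * (fwdDiff 1)^[k] (fun n : ℕ => 1 / (A * h + A * n)) n =
      k.factorial * (1 / A * ∏ i ∈ Finset.range (k + 1), 1 / (h + n + i)) := by
  induction k generalizing n with
  | zero => simp; field_simp
  | succ k ih =>
    rw [Function.iterate_succ_apply', fwdDiff, pow_succ]
    have h₁ := ih n
    have h₂ := ih (n + 1)
    have e : ∀ s t r : ℝ, r * -1 * (s - t) = r * t - r * s := by intros; ring
    rw [e, h₂, h₁]
    clear e ih h₁ h₂
    rw [Finset.prod_range_succ (n := k + 1), Finset.prod_range_succ' (n := k),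
      Finset.prod_range_succ (n := k)]
    have hQ : ∏ i ∈ Finset.range k, 1 / (h + ((n + 1 : ℕ) : ℝ) + i) =
        ∏ i ∈ Finset.range k, 1 / (h + (n : ℝ) + ((i + 1 : ℕ) : ℝ)) := by
      refine Finset.prod_congr rfl fun i _ => ?_
      push_cast
      ring_nf
    rw [hQ, Nat.factorial_succ]
    set Q := ∏ i ∈ Finset.range k, 1 / (h + (n : ℝ) + ((i + 1 : ℕ) : ℝ))
    push_cast
    have e₁ : h + (n : ℝ) ≠ 0 := by positivity
    have e₂ : h + ((n : ℝ) + 1) + k ≠ 0 := by positivity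
    have e₃ : h + (n : ℝ) + (k + 1) ≠ 0 := by positivity
    have e₄ : h + (n : ℝ) + 0 ≠ 0 := by positivity
    field_simp
    ring

/-! ### Divergence of Gamma-type products -/

/-- Each factor is `1 + (t - s) / (s + i)`; expanding bounds the product below by a multiple of the
harmonic series. -/
theorem tendsto_prod_div_atTop {s t : ℝ} (hs : 0 < s) (hst : s < t) :
    Tendsto (fun k => ∏ i ∈ Finset.range k, (t + i) / (s + i)) atTop atTop := by
  have hsum : Tendsto (fun k => (t - s) / (s + 1) * ∑ i ∈ Finset.range k, 1 / ((i : ℝ) + 1))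
      atTop atTop :=
    Real.tendsto_sum_range_one_div_nat_succ_atTop.const_mul_atTop
      (div_pos (sub_pos.2 hst) (by linarith))
  refine tendsto_atTop_mono (fun k => ?_) hsum
  have hle : 1 + ∑ i ∈ Finset.range k, (t - s) / (s + i) ≤
      ∏ i ∈ Finset.range k, (t + i) / (s + i) := by
    induction k with
    | zero => simp
    | succ k ih =>
      rw [Finset.sum_range_succ, Finset.prod_range_succ]
      have hp : 0 < s + k := by positivity
      have e : (t + k) / (s + k) = 1 + (t - s) / (s + k) := by field_simp; ring
      have hd : 0 ≤ (t - s) / (s + k) := div_nonneg (by linarith) hp.le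
      have hS : 0 ≤ ∑ i ∈ Finset.range k, (t - s) / (s + i) :=
        Finset.sum_nonneg fun i _ => div_nonneg (by linarith) (by positivity)
      rw [e]
      nlinarith [mul_nonneg hS hd]
  have hle' : (t - s) / (s + 1) * ∑ i ∈ Finset.range k, 1 / ((i : ℝ) + 1) ≤
      ∑ i ∈ Finset.range k, (t - s) / (s + i) := by
    rw [Finset.mul_sum]
    refine Finset.sum_le_sum fun i _ => ?_
    rw [div_mul_div_comm, mul_one]
    have hi : (0 : ℝ) ≤ i := i.cast_nonneg
    exact div_le_div_of_nonneg_left (by linarith) (by positivity) (by nlinarith)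
  linarith

/-- If `A / ∏ (s + i)` is dominated by `B / ∏ (t + i)` for all lengths of the product, then
`t ≤ s`. -/
theorem le_of_forall_prod_le {A B s t : ℝ} (hA : 0 < A) (hs : 0 < s) (ht : 0 < t)
    (h : ∀ k : ℕ, A * ∏ i ∈ Finset.range (k + 1), 1 / (s + i) ≤
      B * ∏ i ∈ Finset.range (k + 1), 1 / (t + i)) : t ≤ s := by
  by_contra! hst
  obtain ⟨k, hk, hk1⟩ := (((tendsto_prod_div_atTop hs hst).eventually_gt_atTop (B / A)).and
    (eventually_ge_atTop 1)).exists
  obtain ⟨k, rfl⟩ := Nat.exists_eq_add_of_le' hk1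
  have hT : 0 < ∏ i ∈ Finset.range (k + 1), (t + i) :=
    Finset.prod_pos fun i _ => by positivity
  have hS : 0 < ∏ i ∈ Finset.range (k + 1), (s + i) :=
    Finset.prod_pos fun i _ => by positivity
  have := h k
  simp only [Finset.prod_div_distrib, Finset.prod_const_one] at this hk
  rw [mul_one_div, mul_one_div, div_le_div_iff₀ hS hT] at this
  rw [div_lt_div_iff₀ hA hS] at hk
  linarith

theorem tendsto_zero_of_recurrence {y e : ℕ → ℝ} {δ : ℝ} (hδ : 0 < δ) (hy : ∀ k, 0 ≤ y k)
    (he : Tendsto e atTop (𝓝 0))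
    (h : ∀ k : ℕ, (k + 1 + δ) * y (k + 1) ≤ e (k + 1) + (k + 1) * y k) :
    Tendsto y atTop (𝓝 0) := by
  rw [Metric.tendsto_atTop]
  intro η hη
  obtain ⟨K, hK⟩ := eventually_atTop.1 (he.eventually_lt_const
    (show 0 < δ * (η / 2) by positivity))
  have hprod : Tendsto (fun j => (∏ i ∈ Finset.range j,
      ((K + 1 + δ : ℝ) + i) / ((K + 1 : ℝ) + i))⁻¹ * y K) atTop (𝓝 0) := by
    simpa using ((tendsto_prod_div_atTop (s := (K + 1 : ℝ)) (t := K + 1 + δ) (by positivity)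
      (by linarith)).inv_tendsto_atTop).mul_const (y K)
  have hle : ∀ j, y (K + j) - η / 2 ≤ (∏ i ∈ Finset.range j,
      ((K + 1 + δ : ℝ) + i) / ((K + 1 : ℝ) + i))⁻¹ * y K := by
    intro j
    induction j with
    | zero => simp; positivity
    | succ j ih =>
      rw [Finset.prod_range_succ, mul_inv, inv_div]
      have h₁ := h (K + j)
      have h₂ := hK (K + j + 1) (by omega)
      push_cast at h₁
      have hp : (0 : ℝ) < K + 1 + δ + j := by positivity
      -- Once `e < δ η / 2`, the excess `y - η / 2` is multiplied at each step by at most `k / (k +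
      -- δ)`, and these ratios have product zero.
      have h₃ : (K + 1 + δ + j) * (y (K + j + 1) - η / 2) ≤
          (K + 1 + j) * (y (K + j) - η / 2) := by nlinarith
      have h₄ : y (K + j + 1) - η / 2 ≤
          (K + 1 + j) / (K + 1 + δ + j) * (y (K + j) - η / 2) := by
        rw [div_mul_eq_mul_div, le_div_iff₀ hp]
        linarith
      calc y (K + (j + 1)) - η / 2 ≤ (K + 1 + j) / (K + 1 + δ + j) * (y (K + j) - η / 2) := h₄
        _ ≤ (K + 1 + j) / (K + 1 + δ + j) * _ :=
          mul_le_mul_of_nonneg_left ih (by positivity)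
        _ = _ := by ring
  obtain ⟨J, hJ⟩ := eventually_atTop.1 (hprod.eventually_lt_const (half_pos hη))
  refine ⟨K + J, fun n hn => ?_⟩
  obtain ⟨j, rfl⟩ := Nat.exists_eq_add_of_le (show K ≤ n by omega)
  rw [Real.dist_eq, sub_zero, abs_of_nonneg (hy _)]
  have := hJ j (by omega)
  have := hle j
  linarith

/-! ### Newton series -/

/-- The generalized binomial coefficient `x (x - 1) ⋯ (x - k + 1) / k!`. -/
noncomputable def binomialCoeff (x : ℝ) (k : ℕ) : ℝ :=
  ∏ i ∈ Finset.range k, (x - i) / (i + 1)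

theorem binomialCoeff_succ (x : ℝ) (k : ℕ) :
    binomialCoeff x (k + 1) * (k + 1) = binomialCoeff x k * (x - k) := by
  rw [binomialCoeff, Finset.prod_range_succ, ← binomialCoeff]
  field_simp

theorem abs_binomialCoeff_mul_le {x : ℝ} (h₀ : 0 ≤ x) (h₁ : x ≤ 1) (k : ℕ) :
    |binomialCoeff x k * (x - k)| ≤ 1 := by
  induction k with
  | zero => simpa [binomialCoeff, abs_of_nonneg h₀] using h₁
  | succ k ih =>
    have hk : (0 : ℝ) < k + 1 := by positivity
    have e : binomialCoeff x (k + 1) * (x - ((k + 1 : ℕ) : ℝ)) =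
        binomialCoeff x k * (x - k) * ((x - (k + 1)) / (k + 1)) := by
      rw [← binomialCoeff_succ x k]
      push_cast
      field_simp
    have hq : |(x - (k + 1)) / (k + 1)| ≤ 1 := by
      rw [abs_div, abs_of_pos hk, div_le_one hk, abs_le]
      constructor <;> linarith [(k.cast_nonneg : (0 : ℝ) ≤ k)]
    rw [e, abs_mul]
    exact mul_le_one₀ ih (abs_nonneg _) hq

/-- Only the factor `i = 0` is nonnegative; each later `x - i` is nonpositive. -/
theorem neg_one_pow_mul_binomialCoeff_nonpos {x : ℝ} (h₀ : 0 ≤ x) (h₁ : x ≤ 1) (k : ℕ) :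
    (-1) ^ (k + 1) * binomialCoeff x (k + 1) ≤ 0 := by
  induction k with
  | zero => simpa [binomialCoeff] using h₀
  | succ k ih =>
    have hk : (0 : ℝ) < k + 1 + 1 := by positivity
    have h := binomialCoeff_succ x (k + 1)
    push_cast at h
    have e : binomialCoeff x (k + 1 + 1) = binomialCoeff x (k + 1) * (x - (k + 1)) / (k + 1 + 1) :=
      (eq_div_iff hk.ne').2 h
    have hq : 0 ≤ ((k + 1) - x) / (k + 1 + 1) :=
      div_nonneg (by linarith [(k.cast_nonneg : (0 : ℝ) ≤ k)]) hk.le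
    calc (-1) ^ (k + 1 + 1) * binomialCoeff x (k + 1 + 1)
        = ((-1) ^ (k + 1) * binomialCoeff x (k + 1)) * (((k + 1) - x) / (k + 1 + 1)) := by
          rw [e]; ring
      _ ≤ 0 := mul_nonpos_of_nonpos_of_nonneg ih hq

/-- The Newton series of `f` at the nodes `0, 1, 2, …` converges to `f` at `x`, and the
differences of `f` at `0` tend to zero. -/
structure HasNewtonSeriesAt (f : ℝ → ℂ) (x : ℝ) : Prop where
  diff : Tendsto (fun k => (fwdDiff 1)^[k] (fun m : ℕ => f m) 0) atTop (𝓝 0)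
  sum : Tendsto (fun K => ∑ k ∈ Finset.range K,
    (binomialCoeff x k : ℂ) * (fwdDiff 1)^[k] (fun m : ℕ => f m) 0) atTop (𝓝 (f x))

theorem HasNewtonSeriesAt.congr {f g : ℝ → ℂ} {x : ℝ} (hf : HasNewtonSeriesAt f x) (hx : 0 ≤ x)
    (h : ∀ y, 0 ≤ y → f y = g y) : HasNewtonSeriesAt g x := by
  have e : (fun m : ℕ => f m) = fun m : ℕ => g m := funext fun m => h m m.cast_nonneg
  exact ⟨e ▸ hf.diff, e ▸ h x hx ▸ hf.sum⟩

theorem hasNewtonSeriesAt_const (c : ℂ) (x : ℝ) : HasNewtonSeriesAt (fun _ => c) x := by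
  have h0 : ∀ k : ℕ, (fwdDiff 1)^[k + 1] (fun _ : ℕ => c) = fun _ => 0 := by
    intro k
    induction k with
    | zero => ext; simp [fwdDiff]
    | succ k ih => rw [Function.iterate_succ_apply', ih]; ext; simp [fwdDiff]
  constructor
  · rw [← tendsto_add_atTop_iff_nat 1]
    simp only [h0]
    exact tendsto_const_nhds
  · rw [← tendsto_add_atTop_iff_nat 1]
    simp only [Finset.sum_range_succ', h0]
    simp [binomialCoeff]

theorem HasNewtonSeriesAt.add {f g : ℝ → ℂ} {x : ℝ} (hf : HasNewtonSeriesAt f x)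
    (hg : HasNewtonSeriesAt g x) : HasNewtonSeriesAt (fun y => f y + g y) x := by
  have e : ∀ k, (fwdDiff 1)^[k] (fun m : ℕ => f m + g m) 0 =
      (fwdDiff 1)^[k] (fun m : ℕ => f m) 0 + (fwdDiff 1)^[k] (fun m : ℕ => g m) 0 :=
    fun k => congrFun (fwdDiff_iter_add 1 (fun m : ℕ => f m) (fun m : ℕ => g m) k) 0
  constructor
  · simpa only [e, add_zero] using hf.diff.add hg.diff
  · simpa only [e, mul_add, Finset.sum_add_distrib] using hf.sum.add hg.sum

theorem HasNewtonSeriesAt.const_mul {f : ℝ → ℂ} {x : ℝ} (hf : HasNewtonSeriesAt f x) (c : ℂ) :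
    HasNewtonSeriesAt (fun y => c * f y) x := by
  have e : ∀ k, (fwdDiff 1)^[k] (fun m : ℕ => c * f m) 0 =
      c * (fwdDiff 1)^[k] (fun m : ℕ => f m) 0 :=
    fun k => congrFun (fwdDiff_iter_const_smul 1 c (fun m : ℕ => f m) k) 0
  constructor
  · simpa only [e, mul_zero] using hf.diff.const_mul c
  · simpa only [e, mul_left_comm _ c, ← Finset.mul_sum] using hf.sum.const_mul c

theorem fwdDiff_iter_linear_mul (z : ℂ) (g : ℕ → ℂ) (k m : ℕ) :
    (fwdDiff 1)^[k + 1] (fun m : ℕ => (m + z) * g m) m =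
      (z + m + k + 1) * (fwdDiff 1)^[k + 1] g m + (k + 1) * (fwdDiff 1)^[k] g m := by
  induction k generalizing m with
  | zero => simp [fwdDiff]; ring
  | succ k ih =>
    rw [Function.iterate_succ_apply', fwdDiff, ih, ih,
      Function.iterate_succ_apply' (fwdDiff 1) (k + 1) g]
    simp only [fwdDiff]
    have h : (fwdDiff 1)^[k + 1] g m = (fwdDiff 1)^[k] g (m + 1) - (fwdDiff 1)^[k] g m := by
      rw [Function.iterate_succ_apply', fwdDiff]
    push_cast
    linear_combination (-k - 1) * h

/-- Multiplication by `m + z` acts on partial Newton sums as multiplication by `x + z`, up to one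
boundary term. -/
theorem newton_sum_linear_mul (x : ℝ) (z : ℂ) (g : ℕ → ℂ) (K : ℕ) :
    ∑ k ∈ Finset.range (K + 1),
        (binomialCoeff x k : ℂ) * (fwdDiff 1)^[k] (fun m : ℕ => (m + z) * g m) 0 =
      (x + z) * ∑ k ∈ Finset.range (K + 1), (binomialCoeff x k : ℂ) * (fwdDiff 1)^[k] g 0 -
        (binomialCoeff x K * (x - K) : ℝ) * (fwdDiff 1)^[K] g 0 := by
  induction K with
  | zero => simp [binomialCoeff]; ring
  | succ K ih =>
    rw [Finset.sum_range_succ, ih, Finset.sum_range_succ _ (K + 1), fwdDiff_iter_linear_mul]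
    have h : (binomialCoeff x (K + 1) : ℂ) * (K + 1) = binomialCoeff x K * (x - K) := by
      exact_mod_cast binomialCoeff_succ x K
    push_cast
    linear_combination (fwdDiff 1)^[K] g 0 * h

theorem ofReal_add_ne_zero {y : ℝ} (hy : 0 ≤ y) {z : ℂ} (hz : 0 < z.re) : (y + z : ℂ) ≠ 0 := by
  intro h
  have := congrArg Complex.re h
  simp at this
  linarith

/-- With `f = (y + z) g`, the product rule for differences is a recurrence forcing those of `g` to
zero because `Re z > 0`. The boundary term then vanishes, its coefficient being at most `1` in
absolute value. -/
theorem HasNewtonSeriesAt.div_add {f : ℝ → ℂ} {x : ℝ} (hf : HasNewtonSeriesAt f x)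
    (h₀ : 0 ≤ x) (h₁ : x ≤ 1) {z : ℂ} (hz : 0 < z.re) :
    HasNewtonSeriesAt (fun y => f y / (y + z)) x := by
  have hne : ∀ y : ℝ, 0 ≤ y → (y + z : ℂ) ≠ 0 :=
    fun y hy => ofReal_add_ne_zero hy hz
  set g : ℕ → ℂ := fun m => f m / ((m : ℝ) + z) with hg
  have hfg : (fun m : ℕ => f m) = fun m : ℕ => (m + z) * g m := by
    ext m
    have := hne m m.cast_nonneg
    simp only [Complex.ofReal_natCast] at this
    simp only [hg, Complex.ofReal_natCast]
    field_simp
  have hdiff : Tendsto (fun k => (fwdDiff 1)^[k] g 0) atTop (𝓝 0) := by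
    refine tendsto_zero_iff_norm_tendsto_zero.2 (tendsto_zero_of_recurrence hz
      (fun k => norm_nonneg _) (tendsto_zero_iff_norm_tendsto_zero.1 hf.diff) fun k => ?_)
    have e := fwdDiff_iter_linear_mul z g k 0
    rw [← hfg] at e
    have e' : (z + k + 1) * (fwdDiff 1)^[k + 1] g 0 =
        (fwdDiff 1)^[k + 1] (fun m : ℕ => f m) 0 - ((k + 1 : ℝ) : ℂ) * (fwdDiff 1)^[k] g 0 := by
      rw [e]
      push_cast
      ring
    have hre : (k + 1 + z.re : ℝ) ≤ ‖(z + k + 1 : ℂ)‖ := by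
      refine le_trans (le_of_eq ?_) (Complex.re_le_norm _)
      simp
      ring
    calc (k + 1 + z.re) * ‖(fwdDiff 1)^[k + 1] g 0‖
        ≤ ‖(z + k + 1 : ℂ)‖ * ‖(fwdDiff 1)^[k + 1] g 0‖ := by gcongr
      _ = ‖(fwdDiff 1)^[k + 1] (fun m : ℕ => f m) 0 -
            ((k + 1 : ℝ) : ℂ) * (fwdDiff 1)^[k] g 0‖ := by rw [← norm_mul, e']
      _ ≤ _ := by
        refine (norm_sub_le _ _).trans (le_of_eq ?_)
        rw [norm_mul, Complex.norm_real, Real.norm_of_nonneg (by positivity)]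
  refine ⟨hdiff, ?_⟩
  rw [← tendsto_add_atTop_iff_nat 1]
  have hrem : Tendsto (fun K : ℕ => ((binomialCoeff x K * (x - K) : ℝ) : ℂ) *
      (fwdDiff 1)^[K] g 0) atTop (𝓝 0) := by
    refine squeeze_zero_norm (fun K => ?_) (tendsto_zero_iff_norm_tendsto_zero.1 hdiff)
    rw [norm_mul, Complex.norm_real, Real.norm_eq_abs]
    exact mul_le_of_le_one_left (norm_nonneg _) (abs_binomialCoeff_mul_le h₀ h₁ K)
  have hlim := (((tendsto_add_atTop_iff_nat 1).2 hf.sum).add hrem).div_const (x + z : ℂ)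
  rw [add_zero] at hlim
  refine hlim.congr fun K => ?_
  rw [hfg, newton_sum_linear_mul, sub_add_cancel, mul_div_cancel_left₀ _ (hne x h₀)]

/-- A real quadratic polynomial with positive coefficients splits over `ℂ` with roots in the left
half plane. -/
theorem exists_complex_factors {p q : ℝ} (hp : 0 < p) (hq : 0 < q) :
    ∃ z w : ℂ, 0 < z.re ∧ 0 < w.re ∧ z + w = p ∧ z * w = q := by
  obtain ⟨s, hs⟩ := IsAlgClosed.exists_pow_nat_eq ((p : ℂ) ^ 2 - 4 * q) two_pos
  -- A non-real root has real part `p / 2`; a real root `z ≤ 0` would give `z (p - z) ≤ 0 < q`.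
  have key : ∀ z : ℂ, z * (p - z) = q → 0 < z.re := by
    intro z hz
    have hre := congrArg Complex.re hz
    have him := congrArg Complex.im hz
    simp at hre him
    by_cases h : z.im = 0
    · rw [h] at hre
      by_contra! hc
      nlinarith
    · have : z.re = p / 2 := by
        apply mul_left_cancel₀ h
        linarith
      linarith
  have h₁ : ((p + s) / 2) * (p - (p + s) / 2) = q := by linear_combination (-1 / 4) * hs
  have h₂ : ((p - s) / 2) * (p - (p - s) / 2) = q := by linear_combination (-1 / 4) * hs
  exact ⟨(p + s) / 2, (p - s) / 2, key _ h₁, key _ h₂, by ring,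
    by linear_combination (-1 / 4) * hs⟩

theorem HasNewtonSeriesAt.div_quadratic {f : ℝ → ℂ} {x : ℝ} (hf : HasNewtonSeriesAt f x)
    (h₀ : 0 ≤ x) (h₁ : x ≤ 1) {c p q : ℝ} (hp : 0 < p) (hq : 0 < q) :
    HasNewtonSeriesAt (fun y => f y * ((c / (y ^ 2 + p * y + q) : ℝ) : ℂ)) x := by
  obtain ⟨z, w, hz, hw, hzw, hm⟩ := exists_complex_factors hp hq
  convert ((hf.div_add h₀ h₁ hz).div_add h₀ h₁ hw).const_mul c using 2 with y
  have e : ((y ^ 2 + p * y + q : ℝ) : ℂ) = (y + z) * (y + w) := by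
    push_cast
    linear_combination (-y : ℂ) * hzw - hm
  rw [Complex.ofReal_div, e, div_div]
  ring

theorem HasNewtonSeriesAt.linear_mul_div {f : ℝ → ℂ} {x : ℝ} (hf : HasNewtonSeriesAt f x)
    (h₀ : 0 ≤ x) (h₁ : x ≤ 1) {c p q r s : ℝ} (hp : 0 < p) (hq : 0 < q) :
    HasNewtonSeriesAt (fun y => f y *
      ((c * (y + r) * (y + s) / (y ^ 2 + p * y + q) : ℝ) : ℂ)) x := by
  obtain ⟨z, w, hz, hw, hzw, hm⟩ := exists_complex_factors hp hq
  -- `(y + r) / (y + z) = 1 + (r - z) / (y + z)`, and likewise for `s` and `w`.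
  have hg := hf.add ((hf.div_add h₀ h₁ hz).const_mul (r - z))
  have hh := (hg.add ((hg.div_add h₀ h₁ hw).const_mul (s - w))).const_mul c
  refine hh.congr h₀ fun y hy => ?_
  have e : ((y ^ 2 + p * y + q : ℝ) : ℂ) = (y + z) * (y + w) := by
    push_cast
    linear_combination (-y : ℂ) * hzw - hm
  have hz' := ofReal_add_ne_zero hy hz
  have hw' := ofReal_add_ne_zero hy hw
  rw [Complex.ofReal_div, e]
  push_cast
  field_simp
  ring

theorem HasNewtonSeriesAt.tendsto_fwdDiff_ofReal {f : ℝ → ℝ} {x : ℝ}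
    (hf : HasNewtonSeriesAt (fun y => (f y : ℂ)) x) :
    Tendsto (fun k => (fwdDiff 1)^[k] (fun m : ℕ => f m) 0) atTop (𝓝 0) ∧
    Tendsto (fun K => ∑ k ∈ Finset.range K,
      binomialCoeff x k * (fwdDiff 1)^[k] (fun m : ℕ => f m) 0) atTop (𝓝 (f x)) := by
  have e : ∀ k m, (fwdDiff 1)^[k] (fun m : ℕ => (f m : ℂ)) m =
      ((fwdDiff 1)^[k] (fun m : ℕ => f m) m : ℝ) := by
    intro k
    induction k with
    | zero => intro m; rfl
    | succ k ih => intro m; simp [Function.iterate_succ_apply', fwdDiff, ih]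
  obtain ⟨h₁, h₂⟩ := hf
  simp only [e, ← Complex.ofReal_mul, ← Complex.ofReal_sum] at h₁ h₂
  rw [← Complex.ofReal_zero] at h₁
  exact ⟨tendsto_ofReal_iff.1 h₁, tendsto_ofReal_iff.1 h₂⟩

/-- A function whose Newton series converges and whose restriction to the integers is completely
monotone does not exceed its value at `0` on `[0, 1]`. -/
theorem CompletelyMonotoneSeq.le_apply_zero {f : ℝ → ℝ} {x : ℝ} (h₀ : 0 ≤ x) (h₁ : x ≤ 1)
    (hf : HasNewtonSeriesAt (fun y => (f y : ℂ)) x)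
    (hcm : CompletelyMonotoneSeq (fun m : ℕ => f m)) : f x ≤ f 0 := by
  refine le_of_tendsto ((tendsto_add_atTop_iff_nat 1).2 hf.tendsto_fwdDiff_ofReal.2)
    (Eventually.of_forall fun K => ?_)
  rw [Finset.sum_range_succ']
  have : ∑ k ∈ Finset.range K,
      binomialCoeff x (k + 1) * (fwdDiff 1)^[k + 1] (fun m : ℕ => f m) 0 ≤ 0 := by
    refine Finset.sum_nonpos fun k _ => ?_
    have h := mul_nonpos_of_nonpos_of_nonneg (neg_one_pow_mul_binomialCoeff_nonpos h₀ h₁ k)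
      (hcm (k + 1) 0)
    have e : ((-1 : ℝ) ^ (k + 1)) * (-1) ^ (k + 1) = 1 := by
      rw [← mul_pow]; simp
    calc _ = ((-1 : ℝ) ^ (k + 1) * (-1) ^ (k + 1)) * (binomialCoeff x (k + 1) *
        (fwdDiff 1)^[k + 1] (fun m : ℕ => f m) 0) := by rw [e, one_mul]
      _ ≤ 0 := by linarith
  simpa [binomialCoeff] using this

/-! ### Atoms at zero -/

theorem fwdDiff_iter_ite_zero (ε : ℝ) (k m : ℕ) :
    (fwdDiff 1)^[k] (fun m : ℕ => if m = 0 then ε else 0) m =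
      if m = 0 then (-1) ^ k * ε else 0 := by
  induction k generalizing m with
  | zero => simp
  | succ k ih =>
    rw [Function.iterate_succ_apply', fwdDiff, ih, ih]
    by_cases h : m = 0 <;> simp [h, pow_succ]

/-- A sequence whose differences at `0` tend to zero has no removable atom. -/
theorem not_completelyMonotoneSeq_sub {u : ℕ → ℝ} {ε : ℝ} (hε : 0 < ε)
    (hu : Tendsto (fun k => (fwdDiff 1)^[k] u 0) atTop (𝓝 0)) :
    ¬ CompletelyMonotoneSeq (fun k => u k - if k = 0 then ε else 0) := by
  intro h
  obtain ⟨k, hk⟩ := ((tendsto_zero_iff_norm_tendsto_zero.1 hu).eventually_lt_const hε).exists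
  have h₁ := h k 0
  have e : (fun k => u k - if k = 0 then ε else 0) =
      u + (-1 : ℝ) • fun k : ℕ => if k = 0 then ε else 0 := by
    ext
    simp [sub_eq_add_neg]
  rw [e, fwdDiff_iter_add, fwdDiff_iter_const_smul, Pi.add_apply, Pi.smul_apply,
    fwdDiff_iter_ite_zero] at h₁
  have e' : ((-1 : ℝ) ^ k) * (-1) ^ k = 1 := by
    rw [← mul_pow]; simp
  have h₂ : ε ≤ (-1) ^ k * (fwdDiff 1)^[k] u 0 := by
    simp only [if_true, smul_eq_mul] at h₁
    linear_combination h₁ - ε * e'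
  have h₃ : (-1) ^ k * (fwdDiff 1)^[k] u 0 ≤ ‖(fwdDiff 1)^[k] u 0‖ := by
    refine (le_abs_self _).trans (le_of_eq ?_)
    simp [abs_mul, abs_pow]
  linarith

theorem CompletelyMonotoneSeq.antitone_succ {u : ℕ → ℝ} (h : CompletelyMonotoneSeq u) (m : ℕ) :
    u (m + 1) ≤ u m := by
  simpa [fwdDiff] using h 1 m

/-! ### The net of reciprocals -/

theorem nonneg_of_forall_quadratic_nonneg {p q r : ℝ}
    (h : ∀ m : ℕ, 0 ≤ p * (m : ℝ) ^ 2 + q * m + r) : 0 ≤ p := by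
  by_contra! hp
  obtain ⟨m, hm⟩ := exists_nat_gt (max 1 ((|q| + |r|) / (-p)))
  have h₁ : (1 : ℝ) < m := (le_max_left _ _).trans_lt hm
  have h₂ := (le_max_right _ _).trans_lt hm
  rw [div_lt_iff₀ (by linarith)] at h₂
  have h₃ := h m
  have h₄ := mul_lt_mul_of_pos_right h₂ (zero_lt_one.trans h₁)
  have h₅ := mul_nonneg (abs_nonneg r) (sub_nonneg.2 h₁.le)
  have h₆ := mul_nonneg (sub_nonneg.2 (le_abs_self q)) (zero_lt_one.trans h₁).le
  linarith [le_abs_self r]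

/-- The net `1 / (B m + A m * n)` is joint completely monotone iff the sequences
`1 / (A m ∏ (B m / A m + n + i))` are completely monotone. -/
theorem jointCompletelyMonotone_one_div_iff {A B : ℝ → ℝ} (hA : ∀ x, 0 ≤ x → 0 < A x)
    (hB : ∀ x, 0 ≤ x → 0 < B x) :
    JointCompletelyMonotone (fun α : Fin 2 → ℕ => 1 / (B (α 0) + A (α 0) * (α 1))) ↔
      ∀ k n : ℕ, CompletelyMonotoneSeq (fun m : ℕ => k.factorial * (1 / A m *
        ∏ i ∈ Finset.range (k + 1), 1 / (B m / A m + n + i))) := by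
  rw [jointCompletelyMonotone_two_iff (fun m n => 1 / (B m + A m * n))]
  refine forall_congr' fun k => forall_congr' fun n => ?_
  refine Eq.to_iff (congrArg _ (funext fun m => ?_))
  have h₁ := hA m m.cast_nonneg
  rw [← fwdDiff_iter_one_div_linear h₁ (div_pos (hB m m.cast_nonneg) h₁),
    mul_div_cancel₀ _ h₁.ne']

/-- Partial fractions write `b / a` as `b₀ / a₀` minus a combination of `1 / (x + a₂)` and `1 / ((x
+ a₁) (x + a₂))`; the hypotheses say exactly that its coefficients are nonnegative. -/
theorem cmUpTo_ratio_increment {a₀ a₁ a₂ b₀ b₁ b₂ : ℝ} (ha₀ : 0 < a₀) (ha₁ : 0 < a₁)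
    (ha₂ : 0 < a₂) (hb₀ : 0 < b₀) (hs : b₁ + b₂ ≤ a₁ + a₂) (hi : b₁ ≤ a₁ ∧ a₁ ≤ b₂)
    {a b : ℝ → ℝ} (ha : ∀ x, a x = a₀ * (x + a₁) * (x + a₂))
    (hb : ∀ x, b x = b₀ * (x + b₁) * (x + b₂)) (N : ℕ) :
    CMUpTo N (fun m : ℕ => b (m + 1 : ℕ) / a (m + 1 : ℕ) - b m / a m) := by
  have h₁ : CMUpTo (N + 1) (fun m : ℕ => b₀ / a₀ * ((a₁ + a₂ - b₁ - b₂) * (1 / ((m : ℝ) + a₂)) +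
      (a₁ - b₁) * (b₂ - a₁) * (1 / ((m : ℝ) + a₁) * (1 / ((m : ℝ) + a₂))))) :=
    (CMUpTo.const (by positivity) _).mul
      (((CMUpTo.const (by linarith) _).mul (CMUpTo.one_div_add ha₂ _)).add
        ((CMUpTo.const (mul_nonneg (by linarith) (by linarith)) _).mul
          ((CMUpTo.one_div_add ha₁ _).mul (CMUpTo.one_div_add ha₂ _))))
  convert h₁.2 using 2 with m
  have key : ∀ x : ℝ, 0 ≤ x → b x / a x = b₀ / a₀ - b₀ / a₀ * ((a₁ + a₂ - b₁ - b₂) *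
      (1 / (x + a₂)) + (a₁ - b₁) * (b₂ - a₁) * (1 / (x + a₁) * (1 / (x + a₂)))) := by
    intro x hx
    have e₁ : x + a₁ ≠ 0 := by positivity
    have e₂ : x + a₂ ≠ 0 := by positivity
    rw [ha, hb]
    field_simp
    ring
  rw [key _ (Nat.cast_nonneg _), key _ (Nat.cast_nonneg _)]
  ring

theorem jointCompletelyMonotone_of_interlacing {a₀ a₁ a₂ b₀ b₁ b₂ : ℝ} (ha₀ : 0 < a₀)
    (ha₁ : 0 < a₁) (ha₂ : 0 < a₂) (hb₀ : 0 < b₀) (hb₁ : 0 < b₁) (hb₂ : 0 < b₂)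
    (hs : b₁ + b₂ ≤ a₁ + a₂) (hi : b₁ ≤ a₁ ∧ a₁ ≤ b₂)
    {a b : ℝ → ℝ} (ha : ∀ x, a x = a₀ * (x + a₁) * (x + a₂))
    (hb : ∀ x, b x = b₀ * (x + b₁) * (x + b₂)) :
    JointCompletelyMonotone (fun α : Fin 2 → ℕ => 1 / (b (α 0) + a (α 0) * (α 1))) := by
  have hA : ∀ x, 0 ≤ x → 0 < a x := fun x hx => by rw [ha]; positivity
  have hB : ∀ x, 0 ≤ x → 0 < b x := fun x hx => by rw [hb]; positivity
  rw [jointCompletelyMonotone_one_div_iff hA hB]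
  refine fun k n => completelyMonotoneSeq_of_cmUpTo fun N => ?_
  refine (CMUpTo.const (by positivity) N).mul (CMUpTo.mul ?_ (CMUpTo.prod fun i _ => ?_))
  · convert (CMUpTo.const (c := 1 / a₀) (by positivity) N).mul
      ((CMUpTo.one_div_add ha₁ N).mul (CMUpTo.one_div_add ha₂ N)) using 2 with m
    rw [ha, one_div_mul_one_div, one_div_mul_one_div, mul_assoc]
  · refine CMUpTo.one_div (fun m => ?_) (fun N => ?_) N
    · have := div_pos (hB m m.cast_nonneg) (hA m m.cast_nonneg)
      positivity
    · convert cmUpTo_ratio_increment ha₀ ha₁ ha₂ hb₀ hs hi ha hb N using 2 with m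
      ring

/-- Each new factor is `a / (b + (k + 1) a)`. Its denominator has positive coefficients but possibly
non-real roots, hence the complex-valued setting. -/
theorem hasNewtonSeriesAt_one_div_mul_prod {a₀ a₁ a₂ b₀ b₁ b₂ : ℝ} (ha₀ : 0 < a₀)
    (ha₁ : 0 < a₁) (ha₂ : 0 < a₂) (hb₀ : 0 < b₀) (hb₁ : 0 < b₁) (hb₂ : 0 < b₂)
    {a b : ℝ → ℝ} (ha : ∀ x, a x = a₀ * (x + a₁) * (x + a₂))
    (hb : ∀ x, b x = b₀ * (x + b₁) * (x + b₂)) {x : ℝ} (h₀ : 0 ≤ x) (h₁ : x ≤ 1) (k : ℕ) :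
    HasNewtonSeriesAt (fun y => ((1 / a y *
      ∏ i ∈ Finset.range (k + 1), 1 / (b y / a y + i) : ℝ) : ℂ)) x := by
  have hA : ∀ x, 0 ≤ x → 0 < a x := fun x hx => by rw [ha]; positivity
  have hB : ∀ x, 0 ≤ x → 0 < b x := fun x hx => by rw [hb]; positivity
  induction k with
  | zero =>
    refine ((hasNewtonSeriesAt_const 1 x).div_quadratic h₀ h₁ (c := 1 / b₀) (add_pos hb₁ hb₂)
      (mul_pos hb₁ hb₂)).congr h₀ fun y hy => ?_
    rw [one_mul]
    congr 1
    have := (hA y hy).ne'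
    have e : y ^ 2 + (b₁ + b₂) * y + b₁ * b₂ = (y + b₁) * (y + b₂) := by ring
    rw [e, div_div]
    simp only [zero_add, Finset.prod_range_one, Nat.cast_zero, add_zero]
    rw [one_div_mul_one_div, mul_div_cancel₀ _ this, hb, mul_assoc]
  | succ k ih =>
    have hd : 0 < b₀ + (k + 1) * a₀ := by positivity
    refine (ih.linear_mul_div h₀ h₁ (c := a₀ / (b₀ + (k + 1) * a₀)) (r := a₁) (s := a₂)
      (p := (b₀ * (b₁ + b₂) + (k + 1) * a₀ * (a₁ + a₂)) / (b₀ + (k + 1) * a₀))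
      (q := (b₀ * (b₁ * b₂) + (k + 1) * a₀ * (a₁ * a₂)) / (b₀ + (k + 1) * a₀))
      (by positivity) (by positivity)).congr h₀ fun y hy => ?_
    rw [← Complex.ofReal_mul, Finset.prod_range_succ _ (k + 1), ← mul_assoc (1 / a y)]
    congr 1
    refine congrArg (HMul.hMul _) ?_
    have h₂ := hA y hy
    have h₃ := hB y hy
    have e₁ : b y / a y + (k + 1 : ℕ) = (b y + (k + 1) * a y) / a y := by
      push_cast
      field_simp
    have e₂ : b y + (k + 1) * a y = (b₀ + (k + 1) * a₀) * (y ^ 2 +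
        (b₀ * (b₁ + b₂) + (k + 1) * a₀ * (a₁ + a₂)) / (b₀ + (k + 1) * a₀) * y +
        (b₀ * (b₁ * b₂) + (k + 1) * a₀ * (a₁ * a₂)) / (b₀ + (k + 1) * a₀)) := by
      rw [ha, hb]
      field_simp
      ring
    rw [e₁, one_div_div, e₂, ha, div_mul_eq_div_div]
    congr 1
    ring

/-- Minimality costs nothing extra: the axis sequences `1 / b m` and `1 / (b 0 + a 0 n)` always have
differences at `0` tending to zero. -/
theorem minimal_of_jointCompletelyMonotone {a₀ a₁ a₂ b₀ b₁ b₂ : ℝ} (ha₀ : 0 < a₀)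
    (ha₁ : 0 < a₁) (ha₂ : 0 < a₂) (hb₀ : 0 < b₀) (hb₁ : 0 < b₁) (hb₂ : 0 < b₂)
    {a b : ℝ → ℝ} (ha : ∀ x, a x = a₀ * (x + a₁) * (x + a₂))
    (hb : ∀ x, b x = b₀ * (x + b₁) * (x + b₂))
    (h : JointCompletelyMonotone (fun α : Fin 2 → ℕ => 1 / (b (α 0) + a (α 0) * (α 1)))) :
    MinimalJointCompletelyMonotone
      (fun α : Fin 2 → ℕ => 1 / (b (α 0) + a (α 0) * (α 1))) := by
  have hA : 0 < a 0 := by rw [ha]; positivity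
  have hB : 0 < b 0 := by rw [hb]; positivity
  refine ⟨h, fun j ε hε => not_completelyMonotoneSeq_sub hε ?_⟩
  fin_cases j
  · have := (hasNewtonSeriesAt_const 1 0).div_quadratic le_rfl zero_le_one (c := 1 / b₀)
      (add_pos hb₁ hb₂) (mul_pos hb₁ hb₂)
    simp only [one_mul] at this
    convert this.tendsto_fwdDiff_ofReal.1 using 4 with k m
    have e : (m : ℝ) ^ 2 + (b₁ + b₂) * m + b₁ * b₂ = (m + b₁) * (m + b₂) := by ring
    rw [e, div_div]
    simp [hb, mul_assoc]
  · have := ((hasNewtonSeriesAt_const 1 0).div_add le_rfl zero_le_one (z := (b 0 / a 0 : ℝ))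
      (by rw [Complex.ofReal_re]; exact div_pos hB hA)).const_mul (1 / a 0 : ℝ)
    have e : ∀ y : ℝ, ((1 / a 0 : ℝ) : ℂ) * (1 / (y + (b 0 / a 0 : ℝ))) =
        ((1 / (b 0 + a 0 * y) : ℝ) : ℂ) := by
      intro y
      rw [← Complex.ofReal_add, ← Complex.ofReal_one, ← Complex.ofReal_div, ← Complex.ofReal_mul,
        one_div_mul_one_div, mul_add, mul_div_cancel₀ _ hA.ne', add_comm]
    simp only [e] at this
    convert this.tendsto_fwdDiff_ofReal.1 using 4 with k m
    simp

theorem ratio_le_of_jointCompletelyMonotone {a₀ a₁ a₂ b₀ b₁ b₂ : ℝ} (ha₀ : 0 < a₀)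
    (ha₁ : 0 < a₁) (ha₂ : 0 < a₂) (hb₀ : 0 < b₀) (hb₁ : 0 < b₁) (hb₂ : 0 < b₂)
    {a b : ℝ → ℝ} (ha : ∀ x, a x = a₀ * (x + a₁) * (x + a₂))
    (hb : ∀ x, b x = b₀ * (x + b₁) * (x + b₂))
    (h : JointCompletelyMonotone (fun α : Fin 2 → ℕ => 1 / (b (α 0) + a (α 0) * (α 1)))) :
    (∀ m : ℕ, b m / a m ≤ b (m + 1) / a (m + 1)) ∧
      ∀ x, 0 ≤ x → x ≤ 1 → b 0 / a 0 ≤ b x / a x := by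
  have hA : ∀ x, 0 ≤ x → 0 < a x := fun x hx => by rw [ha]; positivity
  have hB : ∀ x, 0 ≤ x → 0 < b x := fun x hx => by rw [hb]; positivity
  have hH : ∀ x, 0 ≤ x → 0 < b x / a x := fun x hx => div_pos (hB x hx) (hA x hx)
  rw [jointCompletelyMonotone_one_div_iff hA hB] at h
  constructor
  · intro m
    refine le_of_forall_prod_le (one_div_pos.2 (hA (m + 1) (by positivity))) (hH _ (by positivity))
      (hH _ (by positivity)) (B := 1 / a m) fun k => ?_
    have := (h k 0).antitone_succ m
    simpa using le_of_mul_le_mul_left this (by positivity)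
  · intro x h₀ h₁
    refine le_of_forall_prod_le (one_div_pos.2 (hA x h₀)) (hH x h₀) (hH 0 le_rfl)
      (B := 1 / a 0) fun k => ?_
    have hN := (hasNewtonSeriesAt_one_div_mul_prod ha₀ ha₁ ha₂ hb₀ hb₁ hb₂ ha hb h₀ h₁
      k).const_mul (k.factorial : ℝ)
    simp only [← Complex.ofReal_mul] at hN
    have := CompletelyMonotoneSeq.le_apply_zero (f := fun y => k.factorial * (1 / a y *
      ∏ i ∈ Finset.range (k + 1), 1 / (b y / a y + i))) h₀ h₁ hN
      (by simpa only [Nat.cast_zero, add_zero] using h k 0)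
    exact le_of_mul_le_mul_left this (by positivity)

theorem theorem3p3 (a₀ a₁ a₂ b₀ b₁ b₂ : ℝ)
    (ha₀ : 0 < a₀) (ha₁ : 0 < a₁) (ha₂ : 0 < a₂)
    (hb₀ : 0 < b₀) (hb₁ : 0 < b₁) (hb₂ : 0 < b₂)
    (ha : a₁ ≤ a₂) (hb : b₁ ≤ b₂)
    (a b : ℝ → ℝ)
    (ha_def : ∀ x, a x = a₀ * (x + a₁) * (x + a₂))
    (hb_def : ∀ x, b x = b₀ * (x + b₁) * (x + b₂)) :
    (((b₁ ≤ a₁ ∧ a₁ ≤ b₂) ∨ (b₁ ≤ a₂ ∧ a₂ ≤ b₂)) ∧ b₁ + b₂ ≤ a₁ + a₂ →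
      MinimalJointCompletelyMonotone
        (fun α : Fin 2 → ℕ => 1 / (b (α 0) + a (α 0) * (α 1)))) ∧
    (JointCompletelyMonotone
        (fun α : Fin 2 → ℕ => 1 / (b (α 0) + a (α 0) * (α 1))) →
      1 / a₁ + 1 / a₂ ≤ 1 / b₁ + 1 / b₂ ∧ b₁ + b₂ ≤ a₁ + a₂) := by
  constructor
  · rintro ⟨hi, hs⟩
    refine minimal_of_jointCompletelyMonotone ha₀ ha₁ ha₂ hb₀ hb₁ hb₂ ha_def hb_def ?_
    rcases hi with hi | hi
    · exact jointCompletelyMonotone_of_interlacing ha₀ ha₁ ha₂ hb₀ hb₁ hb₂ hs hi ha_def hb_def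
    · exact jointCompletelyMonotone_of_interlacing ha₀ ha₂ ha₁ hb₀ hb₁ hb₂ (by linarith) hi
        (fun x => by rw [ha_def]; ring) hb_def
  · intro h
    obtain ⟨h₁, h₂⟩ :=
      ratio_le_of_jointCompletelyMonotone ha₀ ha₁ ha₂ hb₀ hb₁ hb₂ ha_def hb_def h
    have hA : ∀ x, 0 ≤ x → 0 < a x := fun x hx => by rw [ha_def]; positivity
    constructor
    -- This is `h 0 ≤ h x` cross-multiplied: the constant terms cancel, which allows division by
    -- `x`.
    · have h₃ : ∀ x : ℝ, 0 < x → x ≤ 1 →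
          b₁ * b₂ * (a₁ + a₂) - a₁ * a₂ * (b₁ + b₂) ≤ x * (a₁ * a₂ - b₁ * b₂) := by
        intro x hx hx1
        have := h₂ x hx.le hx1
        rw [div_le_div_iff₀ (hA 0 le_rfl) (hA x hx.le), ha_def, ha_def, hb_def, hb_def] at this
        have hc : 0 < a₀ * b₀ * x := by positivity
        refine le_of_mul_le_mul_left ?_ hc
        linear_combination this
      have h₄ : b₁ * b₂ * (a₁ + a₂) - a₁ * a₂ * (b₁ + b₂) ≤ 0 := by
        have ht : Tendsto (fun x : ℝ => x * (a₁ * a₂ - b₁ * b₂)) (𝓝[>] 0) (𝓝 0) := by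
          have : Tendsto (fun x : ℝ => x * (a₁ * a₂ - b₁ * b₂)) (𝓝 0)
              (𝓝 (0 * (a₁ * a₂ - b₁ * b₂))) := tendsto_id.mul_const _
          rw [zero_mul] at this
          exact this.mono_left nhdsWithin_le_nhds
        refine ge_of_tendsto ht ?_
        filter_upwards [Ioc_mem_nhdsGT (zero_lt_one' ℝ)] with x hx using h₃ x hx.1 hx.2
      rw [div_add_div _ _ ha₁.ne' ha₂.ne', div_add_div _ _ hb₁.ne' hb₂.ne',
        div_le_div_iff₀ (by positivity) (by positivity)]
      linarith
    -- `p`, `q`, `r` are the coefficients in `m` of `(b (m + 1) a m - b m a (m + 1)) / (a₀ b₀)`.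
    · have := nonneg_of_forall_quadratic_nonneg (p := (a₁ + a₂) - (b₁ + b₂))
        (q := ((a₁ + a₂) - (b₁ + b₂)) + 2 * (a₁ * a₂ - b₁ * b₂))
        (r := a₁ * a₂ * (1 + b₁ + b₂) - b₁ * b₂ * (1 + a₁ + a₂)) fun m => ?_
      · linarith
      · have := h₁ m
        rw [div_le_div_iff₀ (hA _ (by positivity)) (hA _ (by positivity)),
          ha_def, ha_def, hb_def, hb_def] at this
        have hc : 0 < a₀ * b₀ := by positivity
        refine le_of_mul_le_mul_left ?_ hc
        linear_combination this
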